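/- Let $s\ge 1$ be an integer. An $s$-stage Runge--Kutta method is given by $A=(a_{ij})\in\mathbb R^{s\times s}$, $b\in\mathbb R^s$ and $c\in\mathbb R^s$. It is a collocation method if $c_1,\dots,c_s$ are distinct and, for all $i,j\in\{1,\dots,s\}$, $$a_{ij}=\int_0^{c_i}\ell_j(\tau)\,d\tau,\qquad b_i=\int_0^1\ell_i(\tau)\,d\tau,\qquad \ell_i(\tau)=\prod_{k\ne i}\frac{\tau-c_k}{c_i-c_k}.$$ The Gauss points are the $s$ distinct real zeros of the polynomial $\frac{d^s}{dX^s}\big(X(X-1)\big)^s$. Let $I$ be the identity matrix of size $s$, let $\mathbf 1=(1,\dots,1)^t\in\mathbb R^s$, let $R(\lambda)=1+\lambda b^t(I-\lambda A)^{-1}\mathbf 1$ be the linear stability function (a rational function of $\lambda$), and let $\mathbb C^-=\{\lambda\in\mathbb C:\operatorname{Re}\lambda\le 0\}$. The method is called - $A$-stable if $|R(\lambda)|\le 1$ for all $\lambda\in\mathbb C^-$; - $AS$-stable if $I-\lambda A$ is invertible for all $\lambda\in\mathbb C^-$ and $\lambda\mapsto\lambda b^t(I-\lambda A)^{-1}$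 is bounded on $\mathbb C^-$; - $ASI$-stable if $I-\lambda A$ is invertible for all $\lambda\in\mathbb C^-$ and $\lambda\mapsto(I-\lambda A)^{-1}$ is bounded on $\mathbb C^-$; - $\hat A$-stable if it is $A$-stable, $AS$-stable and $ASI$-stable. $I$-, $IS$-, $ISI$- and $\hat I$-stability are defined in the same way, with $\mathbb C^-$ replaced by the imaginary axis $i\mathbb R$. **Theorem.** For every $s\ge1$, every $s$-stage collocation Runge--Kutta method whose nodes $c_1,\dots,c_s$ are the $s$ Gauss points is $\hat A$-stable and $\hat I$-stable. -/

import Mathlib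

open Polynomial Matrix

/-- The coefficients `A`, `b`, `c` of an `s`-stage Runge–Kutta method (its Butcher tableau). -/
structure RungeKutta (s : ℕ) where
  A : Matrix (Fin s) (Fin s) ℝ
  b : Fin s → ℝ
  c : Fin s → ℝ

/-- The closed left half-plane: complex numbers with nonpositive real part. -/
def closedLeftHalfPlane : Set ℂ := {z | z.re ≤ 0}

/-- The set `iℝ` of purely imaginary numbers (including `0`). -/
def imaginaryAxis : Set ℂ := {z | z.re = 0}

/-- `c₁, …, c_s` are the `s` Gauss points of `[0, 1]`: they are `s` distinct real zeros of the
polynomial `d^s/dX^s (X (X - 1))^s`. This polynomial has degree `s`, so they are all its zeros. -/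
def IsGaussPoints {s : ℕ} (c : Fin s → ℝ) : Prop :=
  Function.Injective c ∧
    ∀ i, (derivative^[s] ((X * (X - 1)) ^ s : ℝ[X])).IsRoot (c i)

namespace RungeKutta

variable {s : ℕ} (M : RungeKutta s)

/-- Collocation methods: the nodes are distinct, `a_{ij} = ∫_0^{c_i} ℓ_j` and `b_i = ∫_0^1 ℓ_i`,
with `ℓ_j` the Lagrange polynomials of the nodes,
`ℓ_j(τ) = ∏_{k ≠ j} (τ - c_k) / (c_j - c_k)`. -/
def IsCollocation : Prop :=
  Function.Injective M.c ∧
    (∀ i j, M.A i j = ∫ τ in (0 : ℝ)..(M.c i), (Lagrange.basis Finset.univ M.c j).eval τ) ∧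
    (∀ i, M.b i = ∫ τ in (0 : ℝ)..1, (Lagrange.basis Finset.univ M.c i).eval τ)

/-- The complex matrix `I - z A`. -/
noncomputable def pencil (z : ℂ) : Matrix (Fin s) (Fin s) ℂ :=
  1 - z • M.A.map (fun x : ℝ => (x : ℂ))

/-- The row vector `z bᵗ (I - z A)⁻¹`. -/
noncomputable def weightRow (z : ℂ) : Fin s → ℂ :=
  z • ((fun i => (M.b i : ℂ)) ᵥ* (M.pencil z)⁻¹)

/-- The linear stability function `R(z) = 1 + z bᵗ (I - z A)⁻¹ 𝟙`. -/
noncomputable def stabilityFunction (z : ℂ) : ℂ :=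
  1 + M.weightRow z ⬝ᵥ (fun _ => 1)

/-- `|R(z)| ≤ 1` at every `z ∈ S` where the formula for `R` makes sense, that is, where `I - z A`
is invertible. Only finitely many `z` are left out, so when `S` is the closed left half-plane or
the imaginary axis, this says, by continuity, that the rational function `R` has no pole in `S`
and satisfies `|R| ≤ 1` on all of `S`. -/
def StableOn (S : Set ℂ) : Prop :=
  ∀ z ∈ S, IsUnit (M.pencil z) → ‖M.stabilityFunction z‖ ≤ 1

/-- For all `z ∈ S` the matrix `I - z A` is invertible, and `z ↦ z bᵗ (I - z A)⁻¹` is uniformly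
bounded on `S` (in the sup norm; all norms on `ℂ^s` are equivalent). -/
def SStableOn (S : Set ℂ) : Prop :=
  (∀ z ∈ S, IsUnit (M.pencil z)) ∧ ∃ K : ℝ, ∀ z ∈ S, ∀ j, ‖M.weightRow z j‖ ≤ K

/-- For all `z ∈ S` the matrix `I - z A` is invertible, and `z ↦ (I - z A)⁻¹` is uniformly
bounded on `S` (in the entrywise sup norm; all norms on matrices are equivalent). -/
def SIStableOn (S : Set ℂ) : Prop :=
  (∀ z ∈ S, IsUnit (M.pencil z)) ∧ ∃ K : ℝ, ∀ z ∈ S, ∀ i j, ‖(M.pencil z)⁻¹ i j‖ ≤ K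

/-- `A`-stability. -/
def IsAStable : Prop := M.StableOn closedLeftHalfPlane

/-- `AS`-stability. -/
def IsASStable : Prop := M.SStableOn closedLeftHalfPlane

/-- `ASI`-stability. -/
def IsASIStable : Prop := M.SIStableOn closedLeftHalfPlane

/-- `I`-stability. -/
def IsIStable : Prop := M.StableOn imaginaryAxis

/-- `IS`-stability. -/
def IsISStable : Prop := M.SStableOn imaginaryAxis

/-- `ISI`-stability. -/
def IsISIStable : Prop := M.SIStableOn imaginaryAxis

/-- `Â`-stability. -/
def IsAHatStable : Prop := M.IsAStable ∧ M.IsASStable ∧ M.IsASIStable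

/-- `Î`-stability. -/
def IsIHatStable : Prop := M.IsIStable ∧ M.IsISStable ∧ M.IsISIStable

end RungeKutta

/-!
The theorem rests on the algebraic stability of the Gauss methods, in its extreme (symplectic)
form, and on the fact that the vectors `A ^ k 𝟙`, `k < s`, span the space of stages.

Since the polynomial `d^s/dX^s (X (X - 1))^s` is orthogonal on `[0, 1]` to all polynomials of
degree less than `s`, the quadrature with nodes `c` and weights `b` is exact up to degree `2 s - 1`
(`RungeKutta.IsCollocation.sum_b_mul_eval_of_degree_lt_two_mul`). Applied to the squares of the
Lagrange polynomials, this gives `b i > 0`; applied to the derivatives of products of their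
antiderivatives, it gives the symplecticity relation `B A + Aᵗ B = b bᵗ` with `B = diag b`
(`RungeKutta.IsCollocation.b_mul_A_add_b_mul_A`). Consequently `2 Re (v* B A v) = |bᵗ v| ^ 2` for
every complex vector `v`.

If `A v = μ v` with `Re μ ≤ 0`, this identity forces `bᵗ v = 0`, so that `vᵗ B` is a left
eigenvector of `A` for `-μ`, orthogonal to `𝟙`. It is then orthogonal to every
`A ^ k 𝟙 = c ^ k / k!` with `k < s`, and the Vandermonde determinant of the nodes yields `v = 0`.
Hence `μ I - A` is invertible whenever `Re μ ≤ 0`, including `μ = 0`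
(`RungeKutta.IsCollocation.isUnit_smul_one_sub`). Therefore `I - z A` is invertible on the closed
left half-plane, and the bounds on `(I - z A)⁻¹` and `z (I - z A)⁻¹` follow by compactness after
the substitution `w = 1 / z` near infinity.

Finally, for the stages `k = (I - z A)⁻¹ 𝟙` the same identity reads
`|R(z)| ^ 2 = 1 + 2 Re z ∑ b i |k i| ^ 2`, which is at most `1` when `Re z ≤ 0`. The statements on
the imaginary axis are restrictions of those on the half-plane.
-/

/-! ### Integrals of polynomials and orthogonality -/

theorem Polynomial.exists_derivative_eq {n : ℕ} {p : ℝ[X]} (hp : p.degree < n) :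
    ∃ P : ℝ[X], derivative P = p ∧ P.eval 0 = 0 ∧ P.natDegree ≤ n := by
  refine ⟨∑ i ∈ Finset.range n, C (p.coeff i / (i + 1)) * X ^ (i + 1), ?_, ?_, ?_⟩
  · rcases Nat.eq_zero_or_pos n with rfl | hn
    · have : p = 0 := by simpa using hp
      simp [this]
    · have hp' : p.natDegree < n := by
        rcases eq_or_ne p 0 with rfl | h0
        · simpa using hn
        · exact (natDegree_lt_iff_degree_lt h0).2 hp
      conv_rhs => rw [p.as_sum_range_C_mul_X_pow' hp']
      rw [derivative_sum]
      refine Finset.sum_congr rfl fun i _ => ?_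
      rw [derivative_C_mul_X_pow]
      have : ((i : ℝ) + 1) ≠ 0 := by positivity
      push_cast
      rw [div_mul_cancel₀ _ this]
  · simp [eval_finsetSum]
  · refine natDegree_sum_le_of_forall_le _ _ fun i hi => ?_
    exact (natDegree_C_mul_X_pow_le _ _).trans (Finset.mem_range.1 hi)

theorem Polynomial.integral_eval_derivative (P : ℝ[X]) (a b : ℝ) :
    ∫ x in a..b, (derivative P).eval x = P.eval b - P.eval a :=
  intervalIntegral.integral_eq_sub_of_hasDerivAt (fun x _ => P.hasDerivAt x)
    ((derivative P).continuous.intervalIntegrable _ _)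

/-- Iterated integration by parts: the boundary terms vanish because `(X (X - 1)) ^ m` has zeros of
order `m` at both end points. -/
theorem Polynomial.integral_iterate_derivative_mul_eq_zero {m k : ℕ} (hk : k ≤ m) (q : ℝ[X])
    (hq : derivative^[k] q = 0) :
    ∫ x in (0 : ℝ)..1, (derivative^[k] ((X * (X - 1)) ^ m : ℝ[X]) * q).eval x = 0 := by
  induction k generalizing q with
  | zero =>
    have : q = 0 := hq
    simp [this]
  | succ k ih =>
    set g : ℝ[X] := derivative^[k] ((X * (X - 1)) ^ m : ℝ[X]) with hg
    have hdvd : (X * (X - 1) : ℝ[X]) ∣ g :=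
      (dvd_pow_self _ (by omega)).trans (pow_sub_dvd_iterate_derivative_pow _ m k)
    have h0 : g.eval 0 = 0 := by
      obtain ⟨r, hr⟩ := hdvd
      simp [hr]
    have h1 : g.eval 1 = 0 := by
      obtain ⟨r, hr⟩ := hdvd
      simp [hr]
    have hbdry := integral_eval_derivative (g * q) 0 1
    have hrest := ih (by omega) (derivative q) hq
    rw [Function.iterate_succ_apply', ← hg]
    simp only [derivative_mul, eval_add] at hbdry
    rw [intervalIntegral.integral_add ((Polynomial.continuous _).intervalIntegrable _ _)
      ((Polynomial.continuous _).intervalIntegrable _ _), hrest] at hbdry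
    simpa [h0, h1] using hbdry

theorem Polynomial.degree_iterate_derivative_X_mul_X_sub_one_pow (s : ℕ) :
    (derivative^[s] ((X * (X - 1)) ^ s : ℝ[X])).degree = s := by
  have hmonic : ((X * (X - 1)) ^ s : ℝ[X]).Monic :=
    (monic_X.mul (monic_X_sub_C 1)).pow s
  have hdeg : ((X * (X - 1)) ^ s : ℝ[X]).natDegree = s + s := by
    rw [← C_1, natDegree_pow, natDegree_mul X_ne_zero (X_sub_C_ne_zero 1), natDegree_X,
      natDegree_X_sub_C, mul_add, mul_one]
  refine degree_eq_of_le_of_coeff_ne_zero ?_ ?_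
  · refine degree_le_of_natDegree_le ((natDegree_iterate_derivative _ _).trans ?_)
    omega
  · have hlead : ((X * (X - 1)) ^ s : ℝ[X]).coeff (s + s) = 1 := by
      rw [← hdeg]
      exact hmonic.coeff_natDegree
    rw [coeff_iterate_derivative, hlead, nsmul_one, Nat.cast_ne_zero, Ne,
      Nat.descFactorial_eq_zero_iff_lt]
    omega

theorem Lagrange.sum_integral_basis_mul_eval {s : ℕ} {c : Fin s → ℝ}
    (hc : Function.Injective c) {p : ℝ[X]} (hp : p.degree < s) (x y : ℝ) :
    ∑ j, (∫ τ in x..y, (Lagrange.basis Finset.univ c j).eval τ) * p.eval (c j)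
      = ∫ τ in x..y, p.eval τ := by
  have hinterp := Lagrange.eq_interpolate (s := Finset.univ) (v := c) hc.injOn (f := p)
    (by simpa using hp)
  conv_rhs => rw [hinterp]
  simp only [Lagrange.interpolate_apply, eval_finsetSum, eval_mul, eval_C]
  rw [intervalIntegral.integral_finsetSum fun j _ =>
    ((Polynomial.continuous _).intervalIntegrable _ _).const_mul _]
  exact Finset.sum_congr rfl fun j _ => by rw [intervalIntegral.integral_const_mul, mul_comm]

/-! ### Complex numbers and matrices -/

theorem Complex.inv_re_nonpos {z : ℂ} (hz : z.re ≤ 0) : z⁻¹.re ≤ 0 := by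
  rw [Complex.inv_re]
  exact div_nonpos_of_nonpos_of_nonneg hz (Complex.normSq_nonneg z)

theorem Matrix.exists_forall_norm_inv_apply_le {n : Type*} [Fintype n] [DecidableEq n]
    {X : Type*} [TopologicalSpace X] {K : Set X} (hK : IsCompact K) {F : X → Matrix n n ℂ}
    (hF : Continuous F) (hunit : ∀ x ∈ K, IsUnit (F x)) :
    ∃ C : ℝ, ∀ x ∈ K, ∀ i j, ‖(F x)⁻¹ i j‖ ≤ C := by
  have hdet : ∀ x ∈ K, (F x).det ≠ 0 := fun x hx =>
    ((Matrix.isUnit_iff_isUnit_det _).1 (hunit x hx)).ne_zero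
  have hcont : ContinuousOn (fun x i j => (F x)⁻¹ i j) K := by
    refine continuousOn_pi.2 fun i => continuousOn_pi.2 fun j => ?_
    simp only [Matrix.inv_def, Ring.inverse_eq_inv', Matrix.smul_apply]
    exact (hF.matrix_det.continuousOn.inv₀ hdet).smul
      (hF.matrix_adjugate.matrix_elem i j).continuousOn
  obtain ⟨C, hC⟩ := hK.exists_bound_of_continuousOn hcont
  exact ⟨C, fun x hx i j => (norm_le_pi_norm (fun j => (F x)⁻¹ i j) j).trans
    ((norm_le_pi_norm (fun i j => (F x)⁻¹ i j) i).trans (hC x hx))⟩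

/-! ### Quadrature at the nodes of a collocation method -/

namespace RungeKutta

variable {s : ℕ} {M : RungeKutta s}

theorem pencil_eq_smul {z : ℂ} (hz : z ≠ 0) :
    M.pencil z = z • (z⁻¹ • 1 - M.A.map (fun x : ℝ => (x : ℂ))) := by
  rw [pencil, smul_sub, smul_smul, mul_inv_cancel₀ hz, one_smul]

namespace IsCollocation

theorem sum_A_mul_eval (hM : M.IsCollocation) {p : ℝ[X]} (hp : p.degree < s) (i : Fin s) :
    ∑ j, M.A i j * p.eval (M.c j) = ∫ τ in (0 : ℝ)..(M.c i), p.eval τ := by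
  simpa only [hM.2.1] using Lagrange.sum_integral_basis_mul_eval hM.1 hp 0 (M.c i)

theorem sum_b_mul_eval (hM : M.IsCollocation) {p : ℝ[X]} (hp : p.degree < s) :
    ∑ j, M.b j * p.eval (M.c j) = ∫ τ in (0 : ℝ)..1, p.eval τ := by
  simpa only [hM.2.2] using Lagrange.sum_integral_basis_mul_eval hM.1 hp 0 1

/-- The simplifying conditions `C(s)`: `A` integrates the powers `c ^ k`, `k < s`. -/
theorem sum_A_mul_pow (hM : M.IsCollocation) {k : ℕ} (hk : k < s) (i : Fin s) :
    (k + 1) * ∑ j, M.A i j * M.c j ^ k = M.c i ^ (k + 1) := by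
  have h := hM.sum_A_mul_eval (p := X ^ k) (by simpa using hk) i
  simp only [eval_pow, eval_X] at h
  rw [h, integral_pow]
  have : (k : ℝ) + 1 ≠ 0 := by positivity
  simp [field]

/-- Gauss quadrature is exact up to degree `2 s - 1`: the remainder of `p` modulo
`W = d^s/dX^s (X (X - 1))^s` has the same values at the nodes as `p`, and also the same integral,
because `W` is orthogonal to the quotient. -/
theorem sum_b_mul_eval_of_degree_lt_two_mul (hM : M.IsCollocation) (hc : IsGaussPoints M.c)
    {p : ℝ[X]} (hp : p.degree < (2 * s : ℕ)) :
    ∑ j, M.b j * p.eval (M.c j) = ∫ τ in (0 : ℝ)..1, p.eval τ := by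
  set W : ℝ[X] := derivative^[s] ((X * (X - 1)) ^ s : ℝ[X]) with hW
  have hdeg : W.degree = s := degree_iterate_derivative_X_mul_X_sub_one_pow s
  have hW0 : W ≠ 0 := by
    rintro h
    simp [h] at hdeg
  have hdecomp : W * (p / W) + p % W = p := EuclideanDomain.div_add_mod p W
  have hquot : (p / W).degree < s := by
    rcases lt_or_ge p.degree W.degree with h | h
    · rw [(Polynomial.div_eq_zero_iff hW0).2 h, degree_zero]
      exact WithBot.bot_lt_coe s
    · have hadd := degree_add_div hW0 h
      by_contra! hge
      have : ((2 * s : ℕ) : WithBot ℕ) ≤ p.degree := by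
        rw [← hadd, hdeg, two_mul, Nat.cast_add]
        gcongr
      exact absurd hp (not_lt.2 this)
  have hrem : (p % W).degree < s := hdeg ▸ EuclideanDomain.mod_lt p hW0
  have horth : ∫ τ in (0 : ℝ)..1, (W * (p / W)).eval τ = 0 :=
    integral_iterate_derivative_mul_eq_zero le_rfl _
      (iterate_derivative_eq_zero_of_degree_lt hquot)
  have hint : ∫ τ in (0 : ℝ)..1, p.eval τ = ∫ τ in (0 : ℝ)..1, (p % W).eval τ := by
    conv_lhs => rw [← hdecomp]
    simp only [eval_add]
    rw [intervalIntegral.integral_add ((Polynomial.continuous _).intervalIntegrable _ _)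
      ((Polynomial.continuous _).intervalIntegrable _ _), horth, zero_add]
  rw [hint, ← hM.sum_b_mul_eval hrem]
  refine Finset.sum_congr rfl fun j _ => ?_
  have hroot : W.eval (M.c j) = 0 := hc.2 j
  conv_lhs => rw [← hdecomp]
  simp [hroot]

/-- Nodewise multiplication by `ℓ_i` reduces a quadrature sum to its term at `c i`. -/
theorem sum_b_mul_basis_mul (hM : M.IsCollocation) (f : Fin s → ℝ) (i : Fin s) :
    ∑ j, M.b j * ((Lagrange.basis Finset.univ M.c i).eval (M.c j) * f j) = M.b i * f i := by
  rw [Finset.sum_eq_single i]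
  · rw [Lagrange.eval_basis_self hM.1.injOn (Finset.mem_univ i), one_mul]
  · intro j _ hj
    rw [Lagrange.eval_basis_of_ne hj.symm (Finset.mem_univ j)]
    ring
  · simp

theorem degree_basis_lt (hM : M.IsCollocation) (i : Fin s) :
    (Lagrange.basis Finset.univ M.c i).degree < s := by
  rw [Lagrange.degree_basis hM.1.injOn (Finset.mem_univ i), Finset.card_univ, Fintype.card_fin]
  exact_mod_cast Nat.sub_lt i.pos one_pos

theorem natDegree_basis_lt (hM : M.IsCollocation) (i : Fin s) :
    (Lagrange.basis Finset.univ M.c i).natDegree < s := by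
  rw [Lagrange.natDegree_basis hM.1.injOn (Finset.mem_univ i), Finset.card_univ, Fintype.card_fin]
  exact Nat.sub_lt i.pos one_pos

/-- The weights are positive, since `b i = ∫ ℓ_i ^ 2`. -/
theorem b_pos (hM : M.IsCollocation) (hc : IsGaussPoints M.c) (i : Fin s) : 0 < M.b i := by
  set l := Lagrange.basis Finset.univ M.c i with hl
  have hdeg : (l * l).degree < (2 * s : ℕ) := by
    refine degree_le_natDegree.trans_lt (Nat.cast_lt.2 (natDegree_mul_le.trans_lt ?_))
    have : l.natDegree < s := hM.natDegree_basis_lt i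
    omega
  have hint := hM.sum_b_mul_eval_of_degree_lt_two_mul hc hdeg
  simp only [eval_mul] at hint
  rw [hM.sum_b_mul_basis_mul (fun j => l.eval (M.c j)) i,
    Lagrange.eval_basis_self hM.1.injOn (Finset.mem_univ i), mul_one] at hint
  rw [hint]
  refine intervalIntegral.integral_pos one_pos
    ((l.continuous.mul l.continuous).continuousOn) (fun x _ => mul_self_nonneg _) ?_
  by_contra! hzero
  refine Lagrange.basis_ne_zero hM.1.injOn (Finset.mem_univ i)
    (eq_zero_of_infinite_isRoot l ((Set.Icc_infinite (zero_lt_one' ℝ)).mono fun x hx => ?_))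
  exact mul_self_eq_zero.1 (le_antisymm (hzero x hx) (mul_self_nonneg _))

/-- The Gauss methods are symplectic: with `L_i` the antiderivative of `ℓ_i`, this is Gauss
quadrature of `(L_i L_j)'`, a polynomial of degree at most `2 s - 1`. -/
theorem b_mul_A_add_b_mul_A (hM : M.IsCollocation) (hc : IsGaussPoints M.c) (i j : Fin s) :
    M.b i * M.A i j + M.b j * M.A j i = M.b i * M.b j := by
  obtain ⟨P, hP, hP0, hPdeg⟩ := exists_derivative_eq (hM.degree_basis_lt i)
  obtain ⟨Q, hQ, hQ0, hQdeg⟩ := exists_derivative_eq (hM.degree_basis_lt j)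
  have hPA : ∀ k, P.eval (M.c k) = M.A k i := fun k => by
    rw [hM.2.1, ← hP, integral_eval_derivative, hP0, sub_zero]
  have hQA : ∀ k, Q.eval (M.c k) = M.A k j := fun k => by
    rw [hM.2.1, ← hQ, integral_eval_derivative, hQ0, sub_zero]
  have hPb : P.eval 1 = M.b i := by
    rw [hM.2.2, ← hP, integral_eval_derivative, hP0, sub_zero]
  have hQb : Q.eval 1 = M.b j := by
    rw [hM.2.2, ← hQ, integral_eval_derivative, hQ0, sub_zero]
  have hdeg : (derivative (P * Q)).degree < (2 * s : ℕ) := by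
    refine degree_le_natDegree.trans_lt (Nat.cast_lt.2 ?_)
    have h1 := natDegree_derivative_le (P * Q)
    have h2 := natDegree_mul_le (p := P) (q := Q)
    have := i.pos
    omega
  have hint := hM.sum_b_mul_eval_of_degree_lt_two_mul hc hdeg
  rw [integral_eval_derivative] at hint
  simp only [derivative_mul, eval_add, eval_mul, hP, hQ, mul_add, Finset.sum_add_distrib, hPA,
    hQA, hP0, hQ0, hPb, hQb] at hint
  rw [hM.sum_b_mul_basis_mul (fun k => M.A k j) i] at hint
  simp only [mul_comm (M.A _ i)] at hint
  rw [hM.sum_b_mul_basis_mul (fun k => M.A k i) j] at hint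
  linarith

/-! ### The spectrum of the coefficient matrix -/

/-- The complex form of `b_mul_A_add_b_mul_A`: the Hermitian part of `diag b * A` is
`b bᵗ / 2`. -/
theorem two_mul_re_sum_b_mul (hM : M.IsCollocation) (hc : IsGaussPoints M.c) (v : Fin s → ℂ) :
    2 * (∑ i, M.b i * (star (v i) * ∑ j, M.A i j * v j) : ℂ).re
      = ‖∑ i, (M.b i : ℂ) * v i‖ ^ 2 := by
  set Q : ℂ := ∑ i, M.b i * (star (v i) * ∑ j, M.A i j * v j) with hQ
  have hQ1 : Q = ∑ i, ∑ j, (M.b i * M.A i j : ℂ) * (star (v i) * v j) := by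
    simp only [hQ, Finset.mul_sum]
    exact Finset.sum_congr rfl fun i _ => Finset.sum_congr rfl fun j _ => by ring
  have hQ2 : star Q = ∑ i, ∑ j, (M.b j * M.A j i : ℂ) * (star (v i) * v j) := by
    rw [hQ1, Finset.sum_comm]
    simp only [star_sum, star_mul', Complex.star_def, Complex.conj_ofReal,
      Complex.conj_conj]
    exact Finset.sum_congr rfl fun i _ => Finset.sum_congr rfl fun j _ => by ring
  have hadd : Q + star Q = star (∑ i, (M.b i : ℂ) * v i) * ∑ i, (M.b i : ℂ) * v i := by
    rw [hQ2, hQ1, ← Finset.sum_add_distrib, star_sum, Finset.sum_mul_sum]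
    refine Finset.sum_congr rfl fun i _ => ?_
    rw [← Finset.sum_add_distrib]
    refine Finset.sum_congr rfl fun j _ => ?_
    have h : (M.b i * M.A i j + M.b j * M.A j i : ℂ) = M.b i * M.b j := by
      exact_mod_cast hM.b_mul_A_add_b_mul_A hc i j
    rw [← add_mul, h, star_mul', Complex.star_def, Complex.conj_ofReal]
    ring
  have hre := congrArg Complex.re hadd
  rw [Complex.star_def, Complex.conj_mul', Complex.add_re, Complex.conj_re,
    ← Complex.ofReal_pow, Complex.ofReal_re] at hre
  linarith

/-- If `A v = μ v` and `bᵗ v = 0`, then `(b i * v i)` is a left eigenvector of `A` for `-μ`, so its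
moments satisfy `m (k + 1) = -(k + 1) μ m k` with `m 0 = 0`; as all of them vanish, so does `v`. -/
theorem eq_zero_of_sum_b_mul_eq_zero (hM : M.IsCollocation) (hc : IsGaussPoints M.c) {μ : ℂ}
    {v : Fin s → ℂ} (hv : ∀ i, ∑ j, (M.A i j : ℂ) * v j = μ * v i)
    (hb : ∑ i, (M.b i : ℂ) * v i = 0) : v = 0 := by
  have hleft : ∀ i, ∑ j, (M.b j * v j) * (M.A j i : ℂ) = -μ * (M.b i * v i) := fun i => by
    have hterm : ∀ j, (M.b j * v j) * (M.A j i : ℂ)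
        = M.b i * (M.b j * v j) - M.b i * (M.A i j * v j) := fun j => by
      have h : (M.b i * M.A i j + M.b j * M.A j i : ℂ) = M.b i * M.b j := by
        exact_mod_cast hM.b_mul_A_add_b_mul_A hc i j
      linear_combination v j * h
    rw [Finset.sum_congr rfl fun j _ => hterm j, Finset.sum_sub_distrib, ← Finset.mul_sum,
      ← Finset.mul_sum, hb, hv]
    ring
  have hmoment : ∀ k : ℕ, k < s → ∑ j, (M.b j * v j) * (M.c j : ℂ) ^ k = 0 := by
    intro k
    induction k with
    | zero => exact fun _ => by simpa using hb
    | succ k ih =>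
      intro hk
      have hpow : ∀ j, (M.c j : ℂ) ^ (k + 1) = (k + 1) * ∑ i, M.A j i * (M.c i : ℂ) ^ k := fun j =>
        by exact_mod_cast (hM.sum_A_mul_pow (by omega : k < s) j).symm
      calc ∑ j, (M.b j * v j) * (M.c j : ℂ) ^ (k + 1)
          = ∑ j, ∑ i, (k + 1) * ((M.c i : ℂ) ^ k * ((M.b j * v j) * M.A j i)) := by
            refine Finset.sum_congr rfl fun j _ => ?_
            rw [hpow, Finset.mul_sum, Finset.mul_sum]
            exact Finset.sum_congr rfl fun i _ => by ring
        _ = ∑ i, (k + 1) * ((M.c i : ℂ) ^ k * (-μ * (M.b i * v i))) := by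
            rw [Finset.sum_comm]
            simp only [← Finset.mul_sum, hleft]
        _ = -(k + 1) * μ * ∑ i, (M.b i * v i) * (M.c i : ℂ) ^ k := by
            rw [Finset.mul_sum]
            exact Finset.sum_congr rfl fun i _ => by ring
        _ = 0 := by rw [ih (by omega), mul_zero]
  have hzero : (fun j => (M.b j * v j : ℂ)) = 0 :=
    Matrix.eq_zero_of_forall_pow_sum_mul_pow_eq_zero
      (Complex.ofReal_injective.comp hM.1) fun k => hmoment k k.2
  funext i
  refine (mul_eq_zero.1 (congrFun hzero i)).resolve_left ?_
  exact_mod_cast (hM.b_pos hc i).ne'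

/-- All eigenvalues of `A` have positive real part. -/
theorem isUnit_smul_one_sub (hM : M.IsCollocation) (hc : IsGaussPoints M.c) {μ : ℂ}
    (hμ : μ.re ≤ 0) :
    IsUnit (μ • (1 : Matrix (Fin s) (Fin s) ℂ) - M.A.map (fun x : ℝ => (x : ℂ))) := by
  rw [Matrix.isUnit_iff_isUnit_det, isUnit_iff_ne_zero]
  intro hdet
  obtain ⟨v, hv0, hv⟩ := Matrix.exists_mulVec_eq_zero_iff.2 hdet
  have heig : ∀ i, ∑ j, (M.A i j : ℂ) * v j = μ * v i := fun i => by
    have h := congrFun hv i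
    rw [Matrix.sub_mulVec, Matrix.smul_mulVec, Matrix.one_mulVec] at h
    exact (sub_eq_zero.1 h).symm
  refine hv0 (hM.eq_zero_of_sum_b_mul_eq_zero hc heig ?_)
  have hre := hM.two_mul_re_sum_b_mul hc v
  have hterm : ∀ i, (M.b i : ℂ) * (star (v i) * (μ * v i))
      = μ * ((M.b i * ‖v i‖ ^ 2 : ℝ) : ℂ) := fun i => by
    have h : star (v i) * v i = ((‖v i‖ ^ 2 : ℝ) : ℂ) := by
      rw [Complex.star_def, Complex.conj_mul', Complex.ofReal_pow]
    rw [Complex.ofReal_mul, ← h]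
    ring
  simp only [heig, hterm] at hre
  rw [← Finset.mul_sum, ← Complex.ofReal_sum, Complex.re_mul_ofReal] at hre
  have hnonneg : 0 ≤ ∑ i, M.b i * ‖v i‖ ^ 2 :=
    Finset.sum_nonneg fun i _ => mul_nonneg (hM.b_pos hc i).le (sq_nonneg _)
  have hle : ‖∑ i, (M.b i : ℂ) * v i‖ ^ 2 ≤ 0 := by
    rw [← hre]
    have := mul_nonpos_of_nonpos_of_nonneg hμ hnonneg
    linarith
  exact norm_eq_zero.1 (pow_eq_zero_iff two_ne_zero |>.1 (le_antisymm hle (sq_nonneg _)))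

theorem isUnit_pencil (hM : M.IsCollocation) (hc : IsGaussPoints M.c) {z : ℂ}
    (hz : z.re ≤ 0) : IsUnit (M.pencil z) := by
  rcases eq_or_ne z 0 with rfl | h0
  · simp [pencil]
  · rw [pencil_eq_smul h0]
    exact (hM.isUnit_smul_one_sub hc (Complex.inv_re_nonpos hz)).smul (Units.mk0 z h0)

/-! ### The stability function -/

/-- With `k = (I - z A)⁻¹ 𝟙`, one has `|R(z)| ^ 2 = 1 + 2 Re z ∑ b i |k i| ^ 2`. -/
theorem norm_stabilityFunction_le_one (hM : M.IsCollocation) (hc : IsGaussPoints M.c) {z : ℂ}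
    (hz : z.re ≤ 0) : ‖M.stabilityFunction z‖ ≤ 1 := by
  set k : Fin s → ℂ := (M.pencil z)⁻¹ *ᵥ fun _ => 1 with hk
  have hdet : IsUnit (M.pencil z).det :=
    (Matrix.isUnit_iff_isUnit_det _).1 (hM.isUnit_pencil hc hz)
  have hstage : ∀ i, 1 = k i - z * ∑ j, M.A i j * k j := fun i => by
    have h : M.pencil z *ᵥ k = fun _ => 1 := by
      rw [hk, Matrix.mulVec_mulVec, Matrix.mul_nonsing_inv _ hdet, Matrix.one_mulVec]
    rw [pencil, Matrix.sub_mulVec, Matrix.smul_mulVec, Matrix.one_mulVec] at h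
    exact (congrFun h i).symm
  set σ : ℂ := ∑ i, (M.b i : ℂ) * k i with hσ
  have hR : M.stabilityFunction z = 1 + z * σ := by
    rw [stabilityFunction, weightRow, smul_dotProduct, ← Matrix.dotProduct_mulVec]
    rfl
  set N : ℝ := ∑ i, M.b i * ‖k i‖ ^ 2 with hN
  have hN0 : 0 ≤ N := Finset.sum_nonneg fun i _ => mul_nonneg (hM.b_pos hc i).le (sq_nonneg _)
  have hre := hM.two_mul_re_sum_b_mul hc k
  set Q : ℂ := ∑ i, M.b i * (star (k i) * ∑ j, M.A i j * k j) with hQ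
  -- Pair `𝟙 = k - z A k` with `k* diag b`.
  have hconj : star σ = N - z * Q := by
    rw [hσ, star_sum, hN, hQ, Complex.ofReal_sum, Finset.mul_sum, ← Finset.sum_sub_distrib]
    refine Finset.sum_congr rfl fun i _ => ?_
    have h : star (k i) * k i = ((‖k i‖ ^ 2 : ℝ) : ℂ) := by
      rw [Complex.star_def, Complex.conj_mul', Complex.ofReal_pow]
    rw [star_mul', Complex.star_def, Complex.conj_ofReal, Complex.ofReal_mul, ← h,
      ← Complex.star_def]
    linear_combination (M.b i * star (k i) : ℂ) * hstage i
  have hsq : ‖M.stabilityFunction z‖ ^ 2 = 1 + 2 * z.re * N := by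
    have h1 := congrArg Complex.re hconj
    have h2 := congrArg Complex.im hconj
    simp only [Complex.star_def, Complex.conj_re, Complex.conj_im, Complex.sub_re, Complex.sub_im,
      Complex.mul_re, Complex.mul_im, Complex.ofReal_re, Complex.ofReal_im] at h1 h2
    rw [← Complex.normSq_eq_norm_sq, Complex.normSq_apply] at hre ⊢
    simp only [hR, Complex.add_re, Complex.add_im, Complex.mul_re, Complex.mul_im, Complex.one_re,
      Complex.one_im]
    linear_combination 2 * z.re * h1 + 2 * z.im * h2 - (z.re ^ 2 + z.im ^ 2) * hre
  have := mul_nonpos_of_nonpos_of_nonneg hz hN0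
  exact (sq_le_one_iff₀ (norm_nonneg _)).1 (by linarith)

/-! ### Uniform bounds -/

/-- On the unit half-disc `(I - z A)⁻¹` is bounded by compactness. Elsewhere
`z (I - z A)⁻¹ = (w I - A)⁻¹` with `w = z⁻¹` in the unit half-disc, where the right-hand side is
continuous, including at `w = 0`. -/
theorem exists_bounds_inv_pencil (hM : M.IsCollocation) (hc : IsGaussPoints M.c) :
    ∃ C : ℝ, ∀ z : ℂ, z.re ≤ 0 → ∀ i j,
      ‖(M.pencil z)⁻¹ i j‖ ≤ C ∧ ‖z * (M.pencil z)⁻¹ i j‖ ≤ C := by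
  have hK : IsCompact (Metric.closedBall (0 : ℂ) 1 ∩ {z | z.re ≤ 0}) :=
    (isCompact_closedBall 0 1).inter_right (isClosed_le Complex.continuous_re continuous_const)
  obtain ⟨C₁, h₁⟩ := Matrix.exists_forall_norm_inv_apply_le hK (F := M.pencil)
    (continuous_const.sub (continuous_id.smul continuous_const))
    fun z hz => hM.isUnit_pencil hc hz.2
  obtain ⟨C₂, h₂⟩ := Matrix.exists_forall_norm_inv_apply_le hK
    (F := fun w : ℂ => w • (1 : Matrix (Fin s) (Fin s) ℂ) - M.A.map (fun x : ℝ => (x : ℂ)))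
    ((continuous_id.smul continuous_const).sub continuous_const)
    fun w hw => hM.isUnit_smul_one_sub hc hw.2
  refine ⟨max C₁ C₂, fun z hz i j => ?_⟩
  rcases le_total ‖z‖ 1 with hz1 | hz1
  · have h := h₁ z ⟨by simpa using hz1, hz⟩ i j
    refine ⟨h.trans (le_max_left _ _), ?_⟩
    rw [norm_mul]
    exact (mul_le_of_le_one_left (norm_nonneg _) hz1).trans (h.trans (le_max_left _ _))
  · have h0 : z ≠ 0 := norm_pos_iff.1 (one_pos.trans_le hz1)
    have h := h₂ z⁻¹ ⟨by simpa using inv_le_one_of_one_le₀ hz1, Complex.inv_re_nonpos hz⟩ i j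
    have hinv : z * (M.pencil z)⁻¹ i j
        = (z⁻¹ • (1 : Matrix (Fin s) (Fin s) ℂ) - M.A.map (fun x : ℝ => (x : ℂ)))⁻¹ i j := by
      have hdet := (Matrix.isUnit_iff_isUnit_det _).1
        (hM.isUnit_smul_one_sub hc (Complex.inv_re_nonpos hz))
      have := invertibleOfNonzero h0
      rw [pencil_eq_smul h0, Matrix.inv_smul _ z hdet, Matrix.smul_apply, invOf_eq_inv,
        smul_eq_mul, mul_inv_cancel_left₀ h0]
    rw [← hinv] at h
    refine ⟨?_, h.trans (le_max_right _ _)⟩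
    rw [norm_mul] at h
    exact (le_mul_of_one_le_left (norm_nonneg _) hz1).trans (h.trans (le_max_right _ _))

theorem sStableOn_closedLeftHalfPlane (hM : M.IsCollocation) (hc : IsGaussPoints M.c) :
    M.SStableOn closedLeftHalfPlane := by
  obtain ⟨C, hC⟩ := hM.exists_bounds_inv_pencil hc
  refine ⟨fun z hz => hM.isUnit_pencil hc hz, ∑ i, ‖(M.b i : ℂ)‖ * C, fun z hz j => ?_⟩
  have hrow : M.weightRow z j = ∑ i, (M.b i : ℂ) * (z * (M.pencil z)⁻¹ i j) := by
    simp only [weightRow, Pi.smul_apply, Matrix.vecMul, dotProduct, smul_eq_mul, Finset.mul_sum]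
    exact Finset.sum_congr rfl fun i _ => by ring
  rw [hrow]
  refine norm_sum_le_of_le _ fun i _ => ?_
  rw [norm_mul]
  exact mul_le_mul_of_nonneg_left (hC z hz i j).2 (norm_nonneg _)

theorem siStableOn_closedLeftHalfPlane (hM : M.IsCollocation) (hc : IsGaussPoints M.c) :
    M.SIStableOn closedLeftHalfPlane := by
  obtain ⟨C, hC⟩ := hM.exists_bounds_inv_pencil hc
  exact ⟨fun z hz => hM.isUnit_pencil hc hz, C, fun z hz i j => (hC z hz i j).1⟩

end IsCollocation

theorem imaginaryAxis_subset_closedLeftHalfPlane : imaginaryAxis ⊆ closedLeftHalfPlane :=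
  fun _ hz => le_of_eq hz

theorem StableOn.mono {S T : Set ℂ} (h : M.StableOn T) (hST : S ⊆ T) : M.StableOn S :=
  fun z hz => h z (hST hz)

theorem SStableOn.mono {S T : Set ℂ} (h : M.SStableOn T) (hST : S ⊆ T) : M.SStableOn S :=
  ⟨fun z hz => h.1 z (hST hz), h.2.imp fun _ hK z hz => hK z (hST hz)⟩

theorem SIStableOn.mono {S T : Set ℂ} (h : M.SIStableOn T) (hST : S ⊆ T) : M.SIStableOn S :=
  ⟨fun z hz => h.1 z (hST hz), h.2.imp fun _ hK z hz => hK z (hST hz)⟩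

end RungeKutta

theorem mainTheorem1 (s : ℕ) (hs : 1 ≤ s) (M : RungeKutta s)
    (hM : M.IsCollocation) (hc : IsGaussPoints M.c) :
    M.IsAHatStable ∧ M.IsIHatStable := by
  have hA : M.StableOn closedLeftHalfPlane := fun z hz _ =>
    hM.norm_stabilityFunction_le_one hc hz
  have hAS := hM.sStableOn_closedLeftHalfPlane hc
  have hASI := hM.siStableOn_closedLeftHalfPlane hc
  have hsub := RungeKutta.imaginaryAxis_subset_closedLeftHalfPlane
  exact ⟨⟨hA, hAS, hASI⟩, hA.mono hsub, hAS.mono hsub, hASI.mono hsub⟩
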